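/- Let $R$ be a Cohen–Macaulay domain, that is, a Noetherian integral domain such that for every maximal ideal $\mathfrak m$ the depth of $R_{\mathfrak m}$ equals its Krull dimension. For a finitely generated $R$-module $M$ the trace of $M$ is the ideal $\operatorname{tr}(M)=\sum_{\varphi\in\operatorname{Hom}_R(M,R)}\varphi(M)$, and an ideal $I\subseteq R$ is called a trace ideal if $I=\operatorname{tr}(M)$ for some finitely generated $R$-module $M$. The grade of a proper ideal $I$ is the supremum of the lengths of $R$-regular sequences contained in $I$, and $\operatorname{grade}(R)=\infty$. Then the following conditions are equivalent: (i) for every nonzero ideal $I$ of $R$, $I$ is a trace ideal if and only if $\operatorname{grade}(I)>1$; (ii) $R$ is normal, i.e. integrally closed in its field of fractions. -/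

import Mathlib

universe u v

/-- The trace of an `R`-module `M`: the sum of the images of all linear maps `M → R`. -/
def moduleTrace (R : Type u) [CommRing R] (M : Type v) [AddCommGroup M] [Module R M] : Ideal R :=
  ⨆ φ : M →ₗ[R] R, LinearMap.range φ

/-- A trace ideal is the trace of a finitely generated module. Every finitely generated module is
isomorphic to one in the universe of `R`, so restricting to that universe loses nothing. -/
def IsTraceIdeal {R : Type u} [CommRing R] (I : Ideal R) : Prop :=
  ∃ (M : Type u) (_ : AddCommGroup M) (_ : Module R M),
    Module.Finite R M ∧ I = moduleTrace R M

open Classical in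
/-- The grade of an ideal: the supremum of the lengths of `R`-regular sequences contained in `I`
if `I` is proper, and `∞` for the unit ideal. -/
noncomputable def idealGrade {R : Type u} [CommRing R] (I : Ideal R) : ℕ∞ :=
  if I = ⊤ then ⊤
  else ⨆ (rs : List R) (_ : (∀ r ∈ rs, r ∈ I) ∧ RingTheory.Sequence.IsRegular R rs),
    (rs.length : ℕ∞)

/-- A local ring is Cohen–Macaulay if it is Noetherian and its depth (the grade of the maximal
ideal) equals its Krull dimension. -/
def IsCohenMacaulayLocal (R : Type u) [CommRing R] [IsLocalRing R] : Prop :=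
  IsNoetherianRing R ∧ ((idealGrade (IsLocalRing.maximalIdeal R) : ℕ∞) : WithBot ℕ∞) = ringKrullDim R

/-- A ring is Cohen–Macaulay if it is Noetherian and its localizations at maximal ideals are
Cohen–Macaulay local rings. -/
def IsCohenMacaulay (R : Type u) [CommRing R] : Prop :=
  IsNoetherianRing R ∧
    ∀ (m : Ideal R) [m.IsMaximal], IsCohenMacaulayLocal (Localization.AtPrime m)

/-!
For an ideal `I` of a Noetherian domain `R`, write `1 / I` for the fractions `y` with `y I ⊆ R` and
`I / I` for those with `y I ⊆ I`; multiplication identifies `1 / I` with `Hom(I, R)`. Hence `I` is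
a trace ideal if and only if `1 / I ⊆ I / I`, while for `I ≠ 0` the vanishing of `Hom(R / I, R / a)`
for `0 ≠ a ∈ I` shows that `I` has grade at least two if and only if `1 / I ⊆ R`.

If `R` is normal, then `I / I = R` by the determinant trick, so the two conditions agree.
Conversely, let `x` be an integral fraction. The conductor `C` of `R[x]` is a nonzero ideal of
`R[x]`, so `y C ⊆ R` implies `y C R[x] ⊆ R`, that is, `y C ⊆ C`, and `C` is a trace ideal. If it has
grade at least two, then `R[x] ⊆ 1 / C ⊆ R`.
-/

open IsLocalization RingTheory.Sequence

section TraceIdeal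

variable {R : Type u} [CommRing R]

theorem apply_mem_moduleTrace {M : Type v} [AddCommGroup M] [Module R M] (φ : M →ₗ[R] R) (m : M) :
    φ m ∈ moduleTrace R M :=
  le_iSup (fun ψ : M →ₗ[R] R => LinearMap.range ψ) φ ⟨m, rfl⟩

theorem linearMap_apply_mem_moduleTrace {M : Type v} [AddCommGroup M] [Module R M]
    (φ : moduleTrace R M →ₗ[R] R) (x : moduleTrace R M) : φ x ∈ moduleTrace R M := by
  suffices h : moduleTrace R M ≤
      (Submodule.comap φ (moduleTrace R M)).map (Submodule.subtype _) by
    obtain ⟨y, hy, hyx⟩ := h x.2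
    rwa [Subtype.ext hyx] at hy
  refine iSup_le fun ψ => ?_
  rintro _ ⟨m, rfl⟩
  let ψ' : M →ₗ[R] moduleTrace R M := ψ.codRestrict _ (apply_mem_moduleTrace ψ)
  exact ⟨ψ' m, apply_mem_moduleTrace (φ ∘ₗ ψ') m, rfl⟩

theorem isTraceIdeal_iff_forall_linearMap_apply_mem {I : Ideal R} (hI : I.FG) :
    IsTraceIdeal I ↔ ∀ (φ : I →ₗ[R] R) (x : I), φ x ∈ I := by
  constructor
  · rintro ⟨M, _, _, _, rfl⟩
    exact linearMap_apply_mem_moduleTrace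
  · intro h
    refine ⟨I, inferInstance, inferInstance, Module.Finite.iff_fg.mpr hI, le_antisymm ?_ ?_⟩
    · exact fun x hx => apply_mem_moduleTrace I.subtype ⟨x, hx⟩
    · refine iSup_le fun φ => ?_
      rintro _ ⟨x, rfl⟩
      exact h φ x

end TraceIdeal

section LinearForms

variable {R : Type u} [CommRing R] {I : Ideal R}

theorem mul_linearMap_apply_comm (φ : I →ₗ[R] R) (x y : I) : (x : R) * φ y = y * φ x := by
  rw [← smul_eq_mul, ← smul_eq_mul, ← map_smul, ← map_smul]
  exact congrArg φ (Subtype.ext (mul_comm _ _))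

variable {K : Type v}

theorem mem_div_coeSubmodule_iff [CommRing K] [Algebra R K] {N : Submodule R K} {y : K} :
    y ∈ N / coeSubmodule K I ↔ ∀ a ∈ I, y * algebraMap R K a ∈ N := by
  simp [Submodule.mem_div_iff_forall_mul_mem]

theorem exists_linearMap_of_mem_one_div [CommRing K] [Algebra R K] [FaithfulSMul R K] {y : K}
    (hy : y ∈ 1 / coeSubmodule K I) :
    ∃ φ : I →ₗ[R] R, ∀ x : I, algebraMap R K (φ x) = y * algebraMap R K x := by
  let mulY : I →ₗ[R] K := LinearMap.mulLeft R y ∘ₗ Algebra.linearMap R K ∘ₗ I.subtype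
  have hrange (x : I) : mulY x ∈ LinearMap.range (Algebra.linearMap R K) := by
    rw [← Submodule.one_eq_range]
    exact mem_div_coeSubmodule_iff.mp hy x x.2
  let e := LinearEquiv.ofInjective (Algebra.linearMap R K) (FaithfulSMul.algebraMap_injective R K)
  exact ⟨e.symm ∘ₗ mulY.codRestrict _ hrange,
    fun x => congrArg Subtype.val (e.apply_symm_apply ⟨mulY x, hrange x⟩)⟩

variable [Field K] [Algebra R K] [FaithfulSMul R K]

theorem exists_algebraMap_linearMap_apply_eq_mul (φ : I →ₗ[R] R) :
    ∃ y : K, ∀ x : I, algebraMap R K (φ x) = y * algebraMap R K x := by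
  obtain rfl | hI := eq_or_ne I ⊥
  · exact ⟨0, fun x => by simp [Subsingleton.elim x 0]⟩
  obtain ⟨a, ha, ha0⟩ := I.ne_bot_iff.mp hI
  have haK : algebraMap R K a ≠ 0 := by simpa using ha0
  refine ⟨algebraMap R K (φ ⟨a, ha⟩) / algebraMap R K a, fun x => ?_⟩
  rw [div_mul_eq_mul_div, eq_div_iff haK, ← map_mul, ← map_mul, mul_comm (φ x),
    mul_linearMap_apply_comm φ ⟨a, ha⟩ x, mul_comm]

variable (K) in
theorem isTraceIdeal_iff_one_div_le_div_self (hI : I.FG) :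
    IsTraceIdeal I ↔ 1 / coeSubmodule K I ≤ coeSubmodule K I / coeSubmodule K I := by
  rw [isTraceIdeal_iff_forall_linearMap_apply_mem hI]
  constructor
  · intro h y hy
    obtain ⟨φ, hφ⟩ := exists_linearMap_of_mem_one_div hy
    exact mem_div_coeSubmodule_iff.mpr fun a ha => ⟨φ ⟨a, ha⟩, h φ ⟨a, ha⟩, hφ ⟨a, ha⟩⟩
  · intro h φ x
    obtain ⟨y, hφ⟩ := exists_algebraMap_linearMap_apply_eq_mul (K := K) φ
    have hy : y ∈ 1 / coeSubmodule K I := mem_div_coeSubmodule_iff.mpr fun a ha =>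
      Submodule.mem_one.mpr ⟨φ ⟨a, ha⟩, hφ ⟨a, ha⟩⟩
    obtain ⟨b, hb, hbx⟩ := mem_div_coeSubmodule_iff.mp (h hy) x x.2
    rwa [← FaithfulSMul.algebraMap_injective R K (hbx.trans (hφ x).symm)]

end LinearForms

section Grade

variable {R : Type u} [CommRing R]

theorem isWeaklyRegular_replicate_one (n : ℕ) (M : Type v) [AddCommGroup M] [Module R M] :
    IsWeaklyRegular M (List.replicate n (1 : R)) := by
  induction n generalizing M with
  | zero => exact .nil R M
  | succ n ih => exact .cons (.one M) (ih _)

theorem isRegular_of_isWeaklyRegular_of_forall_mem {I : Ideal R} (hI : I ≠ ⊤) {rs : List R}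
    (hrs : IsWeaklyRegular R rs) (hmem : ∀ r ∈ rs, r ∈ I) : IsRegular R rs where
  toIsWeaklyRegular := hrs
  top_ne_smul h := by
    rw [smul_eq_mul, Ideal.mul_top] at h
    exact hI (top_le_iff.mp (h.le.trans (Ideal.span_le.mpr hmem)))

theorem natCast_le_idealGrade_iff {I : Ideal R} {n : ℕ} :
    n ≤ idealGrade I ↔ ∃ rs : List R, rs.length = n ∧ (∀ r ∈ rs, r ∈ I) ∧ IsWeaklyRegular R rs := by
  obtain rfl | hI := eq_or_ne I ⊤
  · simpa [idealGrade] using ⟨_, List.length_replicate, isWeaklyRegular_replicate_one n R⟩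
  simp only [idealGrade, if_neg hI]
  constructor
  · intro h
    cases n with
    | zero => exact ⟨[], rfl, by simp, .nil R R⟩
    | succ n =>
      rw [Nat.cast_add_one, ENat.add_one_le_iff (ENat.natCast_ne_top n)] at h
      simp only [lt_iSup_iff, Nat.cast_lt] at h
      obtain ⟨rs, ⟨hmem, hreg⟩, hlen⟩ := h
      have hsplit := hreg.toIsWeaklyRegular
      rw [← List.take_append_drop (n + 1) rs, isWeaklyRegular_append_iff] at hsplit
      exact ⟨rs.take (n + 1), List.length_take_of_le hlen,
        fun r hr => hmem r (List.mem_of_mem_take hr), hsplit.1⟩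
  · rintro ⟨rs, rfl, hmem, hreg⟩
    exact le_iSup₂_of_le rs ⟨hmem, isRegular_of_isWeaklyRegular_of_forall_mem hI hreg hmem⟩ le_rfl

theorem one_lt_idealGrade_iff_exists_isWeaklyRegular {I : Ideal R} :
    1 < idealGrade I ↔ ∃ a ∈ I, ∃ b ∈ I, IsWeaklyRegular R [a, b] := by
  rw [← ENat.add_one_le_iff ENat.one_ne_top, one_add_one_eq_two, ← Nat.cast_ofNat,
    natCast_le_idealGrade_iff]
  simp only [List.length_eq_two]
  constructor
  · rintro ⟨_, ⟨a, b, rfl⟩, hmem, hreg⟩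
    exact ⟨a, hmem a (by simp), b, hmem b (by simp), hreg⟩
  · rintro ⟨a, ha, b, hb, hreg⟩
    exact ⟨_, ⟨a, b, rfl⟩, by simp [ha, hb], hreg⟩

theorem isWeaklyRegular_pair_iff {M : Type v} [AddCommGroup M] [Module R M] {a b : R} :
    IsWeaklyRegular M [a, b] ↔ IsSMulRegular M a ∧ IsSMulRegular (QuotSMulTop a M) b := by
  rw [isWeaklyRegular_cons_iff, isWeaklyRegular_singleton_iff]

theorem quotSMulTop_mk_eq_zero_iff_dvd {a x : R} :
    (Submodule.Quotient.mk x : QuotSMulTop a R) = 0 ↔ a ∣ x := by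
  rw [Submodule.Quotient.mk_eq_zero, Submodule.mem_smul_pointwise_iff_exists]
  simp [dvd_def, eq_comm]

theorem dvd_of_isSMulRegular_quotSMulTop {a b x : R} (h : IsSMulRegular (QuotSMulTop a R) b)
    (hx : a ∣ b * x) : a ∣ x := by
  rw [← quotSMulTop_mk_eq_zero_iff_dvd] at hx ⊢
  exact h.right_eq_zero_of_smul hx

theorem exists_mem_isSMulRegular_quotSMulTop [IsNoetherianRing R] {I : Ideal R} {a : R}
    (h : ∀ c, (∀ i ∈ I, a ∣ i * c) → a ∣ c) : ∃ b ∈ I, IsSMulRegular (QuotSMulTop a R) b := by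
  have hsub : Subsingleton (R ⧸ I →ₗ[R] QuotSMulTop a R) := by
    refine subsingleton_of_forall_eq 0 fun f => ?_
    obtain ⟨c, hc⟩ := Submodule.Quotient.mk_surjective _ (f 1)
    have hdvd : a ∣ c := h c fun i hi => by
      rw [← quotSMulTop_mk_eq_zero_iff_dvd, ← smul_eq_mul, Submodule.Quotient.mk_smul, hc,
        ← map_smul, Algebra.smul_def, mul_one, Ideal.Quotient.algebraMap_eq,
        Ideal.Quotient.eq_zero_iff_mem.mpr hi, map_zero]
    ext
    exact hc.symm.trans (quotSMulTop_mk_eq_zero_iff_dvd.mpr hdvd)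
  rw [IsSMulRegular.subsingleton_linearMap_iff, Ideal.annihilator_quotient] at hsub
  exact hsub

variable {K : Type v} [Field K] [Algebra R K] [FaithfulSMul R K] {I : Ideal R}

theorem one_div_le_one_of_one_lt_idealGrade (h : 1 < idealGrade I) : 1 / coeSubmodule K I ≤ 1 := by
  obtain ⟨a, ha, b, hb, hab⟩ := one_lt_idealGrade_iff_exists_isWeaklyRegular.mp h
  obtain ⟨hareg, hbreg⟩ := isWeaklyRegular_pair_iff.mp hab
  have : Nontrivial R := (algebraMap R K).domain_nontrivial
  have haK : algebraMap R K a ≠ 0 := by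
    simpa using fun ha0 : a = 0 => IsSMulRegular.not_zero (ha0 ▸ hareg)
  intro y hy
  obtain ⟨φ, hφ⟩ := exists_linearMap_of_mem_one_div hy
  obtain ⟨c, hc⟩ : a ∣ φ ⟨a, ha⟩ := dvd_of_isSMulRegular_quotSMulTop hbreg
    ⟨φ ⟨b, hb⟩, mul_linearMap_apply_comm φ ⟨b, hb⟩ ⟨a, ha⟩⟩
  refine Submodule.mem_one.mpr ⟨c, mul_left_cancel₀ haK ?_⟩
  rw [← map_mul, ← hc, hφ, mul_comm]

theorem one_lt_idealGrade_of_one_div_le_one [IsNoetherianRing R] (hI : I ≠ ⊥)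
    (h : 1 / coeSubmodule K I ≤ 1) : 1 < idealGrade I := by
  have hinj := FaithfulSMul.algebraMap_injective R K
  obtain ⟨a, ha, ha0⟩ := I.ne_bot_iff.mp hI
  have haK : algebraMap R K a ≠ 0 := by simpa using ha0
  have hareg : IsSMulRegular R a := fun x y hxy => hinj <| mul_left_cancel₀ haK <| by
    simpa only [smul_eq_mul, map_mul] using congrArg (algebraMap R K) hxy
  suffices hdvd : ∀ c, (∀ i ∈ I, a ∣ i * c) → a ∣ c by
    obtain ⟨b, hb, hbreg⟩ := exists_mem_isSMulRegular_quotSMulTop hdvd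
    exact one_lt_idealGrade_iff_exists_isWeaklyRegular.mpr
      ⟨a, ha, b, hb, isWeaklyRegular_pair_iff.mpr ⟨hareg, hbreg⟩⟩
  intro c hc
  have hfrac : algebraMap R K c / algebraMap R K a ∈ 1 / coeSubmodule K I := by
    refine mem_div_coeSubmodule_iff.mpr fun i hi => ?_
    obtain ⟨d, hd⟩ := hc i hi
    refine Submodule.mem_one.mpr ⟨d, ?_⟩
    rw [div_mul_eq_mul_div, eq_div_iff haK, ← map_mul, ← map_mul, mul_comm d, ← hd, mul_comm]
  obtain ⟨d, hd⟩ := Submodule.mem_one.mp (h hfrac)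
  refine ⟨d, hinj ?_⟩
  rw [map_mul, hd, mul_div_cancel₀ _ haK]

variable (K) in
theorem one_lt_idealGrade_iff_one_div_le_one [IsNoetherianRing R] (hI : I ≠ ⊥) :
    1 < idealGrade I ↔ 1 / coeSubmodule K I ≤ 1 :=
  ⟨one_div_le_one_of_one_lt_idealGrade, one_lt_idealGrade_of_one_div_le_one hI⟩

end Grade

section Normality

variable {R : Type u} [CommRing R] {K : Type v}

theorem div_self_le_one_of_isIntegrallyClosedIn [Field K] [Algebra R K] [IsIntegrallyClosedIn R K]
    {N : Submodule R K} (hN : N ≠ ⊥) (hfg : N.FG) : N / N ≤ 1 := fun x hx =>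
  Submodule.mem_one.mpr <| IsIntegrallyClosedIn.isIntegral_iff.mp <|
    isIntegral_of_smul_mem_submodule N hN hfg x (Submodule.mem_div_iff_forall_mul_mem.mp hx)

/-- The conductor `(R : S)` of a subalgebra `S` of an `R`-algebra `A`, as an ideal of `R`: the
elements of `R` that multiply `S` into the image of `R`. -/
def subalgebraConductor {A : Type v} [CommRing A] [Algebra R A] (S : Subalgebra R A) : Ideal R :=
  (1 / Subalgebra.toSubmodule S).comap (Algebra.linearMap R A)

theorem coeSubmodule_subalgebraConductor {A : Type v} [CommRing A] [Algebra R A]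
    (S : Subalgebra R A) :
    coeSubmodule A (subalgebraConductor S) = 1 / Subalgebra.toSubmodule S := by
  refine Submodule.map_comap_eq_of_le fun y hy => ?_
  rw [← Submodule.one_eq_range]
  simpa using Submodule.mem_div_iff_forall_mul_mem.mp hy 1 S.one_mem

theorem toSubmodule_le_one_div_coeSubmodule_subalgebraConductor {A : Type v} [CommRing A]
    [Algebra R A] (S : Subalgebra R A) :
    Subalgebra.toSubmodule S ≤ 1 / coeSubmodule A (subalgebraConductor S) := by
  rw [coeSubmodule_subalgebraConductor, Submodule.le_div_iff_mul_le]
  exact Submodule.mul_one_div_le_one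

theorem isTraceIdeal_subalgebraConductor [Field K] [Algebra R K] [FaithfulSMul R K]
    (S : Subalgebra R K) (hS : (subalgebraConductor S).FG) :
    IsTraceIdeal (subalgebraConductor S) := by
  rw [isTraceIdeal_iff_one_div_le_div_self K hS, coeSubmodule_subalgebraConductor]
  set T := Subalgebra.toSubmodule S
  have hT : 1 / T * T ≤ 1 / T := by
    rw [Submodule.le_div_iff_mul_le, mul_assoc, S.isIdempotentElem_toSubmodule.eq, mul_comm]
    exact Submodule.mul_one_div_le_one
  rw [Submodule.le_div_iff_mul_le, Submodule.le_div_iff_mul_le, mul_assoc]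
  calc 1 / (1 / T) * (1 / T * T) ≤ 1 / (1 / T) * (1 / T) := mul_le_mul_right hT _
    _ ≤ 1 := by
      rw [mul_comm]
      exact Submodule.mul_one_div_le_one

theorem subalgebraConductor_ne_bot_of_fg [Nontrivial R] [CommRing K] [Algebra R K]
    [IsFractionRing R K] {S : Subalgebra R K} (hS : (Subalgebra.toSubmodule S).FG) :
    subalgebraConductor S ≠ ⊥ := by
  obtain ⟨a, ha, haS⟩ := FractionalIdeal.isFractional_of_fg (S := nonZeroDivisors R) hS
  refine (Submodule.ne_bot_iff _).mpr ⟨a, ?_, nonZeroDivisors.ne_zero ha⟩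
  refine Submodule.mem_div_iff_forall_mul_mem.mpr fun s hs => Submodule.mem_one.mpr ?_
  obtain ⟨t, ht⟩ := haS s hs
  exact ⟨t, by rw [ht, Algebra.smul_def, Algebra.linearMap_apply]⟩

theorem isIntegrallyClosed_of_forall_isTraceIdeal [IsDomain R] [IsNoetherianRing R]
    (h : ∀ I : Ideal R, I ≠ ⊥ → IsTraceIdeal I → 1 < idealGrade I) : IsIntegrallyClosed R := by
  refine (isIntegrallyClosed_iff (FractionRing R)).mpr fun {x} hx => Submodule.mem_one.mp ?_
  set S := Algebra.adjoin R {x}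
  have hgrade : 1 < idealGrade (subalgebraConductor S) :=
    h _ (subalgebraConductor_ne_bot_of_fg hx.fg_adjoin_singleton)
      (isTraceIdeal_subalgebraConductor S (IsNoetherian.noetherian _))
  have hxS : x ∈ Subalgebra.toSubmodule S := Algebra.self_mem_adjoin_singleton R x
  exact one_div_le_one_of_one_lt_idealGrade hgrade
    (toSubmodule_le_one_div_coeSubmodule_subalgebraConductor S hxS)

theorem isTraceIdeal_iff_one_lt_idealGrade [IsDomain R] [IsNoetherianRing R] [IsIntegrallyClosed R]
    {I : Ideal R} (hI : I ≠ ⊥) : IsTraceIdeal I ↔ 1 < idealGrade I := by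
  let K := FractionRing R
  have hfg : I.FG := IsNoetherian.noetherian I
  rw [isTraceIdeal_iff_one_div_le_div_self K hfg, one_lt_idealGrade_iff_one_div_le_one K hI]
  have hdiv_le_one : coeSubmodule K I / coeSubmodule K I ≤ 1 :=
    div_self_le_one_of_isIntegrallyClosedIn
      (coeSubmodule_bot K (R := R) ▸ (IsFractionRing.coeSubmodule_injective R K).ne hI)
      (Submodule.FG.map _ hfg)
  have one_le_div : 1 ≤ coeSubmodule K I / coeSubmodule K I :=
    Submodule.le_div_iff_mul_le.mpr (one_mul _).le
  exact ⟨fun h => h.trans hdiv_le_one, fun h => h.trans one_le_div⟩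

end Normality

theorem mainTheorem3_general (R : Type u) [CommRing R] [IsDomain R] [IsNoetherianRing R] :
    (∀ I : Ideal R, I ≠ ⊥ → (IsTraceIdeal I ↔ 1 < idealGrade I)) ↔ IsIntegrallyClosed R :=
  ⟨fun h => isIntegrallyClosed_of_forall_isTraceIdeal fun I hI => (h I hI).mp,
    fun _ _ hI => isTraceIdeal_iff_one_lt_idealGrade hI⟩

theorem mainTheorem3 (R : Type u) [CommRing R] [IsDomain R] (hR : IsCohenMacaulay R) :
    (∀ I : Ideal R, I ≠ ⊥ → (IsTraceIdeal I ↔ 1 < idealGrade I)) ↔ IsIntegrallyClosed R := by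
  have := hR.1
  exact mainTheorem3_general R
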